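/- Let $c\in\mathbb R$ with $c^2<1$ and put $\gamma:=1/(c^2-1)$. Let $f:\mathbb R\to\mathbb R$ be a subluminal librational wave of the sine-Gordon equation $u_{tt}-u_{xx}+\sin u=0$ with speed $c$, that is, a solution on $\mathbb R$ of the pendulum equation $(c^2-1)f''+\sin f=0$ whose orbit in the phase plane is a non-equilibrium orbit inside the separatrix; equivalently, its energy $E=\tfrac12(c^2-1)(f')^2+1-\cos f$ satisfies $0<E<2$. Then $f$ has a fundamental period $T$, i.e. there is a smallest $T>0$ with $f(z+T)\equiv f(z)\pmod{2\pi}$ for all $z$. Consider the spectral problem $$p''-2c\gamma\lambda p'+\gamma\left[\lambda^2+\cos(f(z))\right]p=0.\qquad(\mathbf P)$$ Call $\lambda\in\mathbb C$ a temporal eigenvalue if $(\mathbf P)$ has a nontrivial solution $p:\mathbb R\to\mathbb C$ that is bounded on $\mathbb R$. The Floquet multipliers of $(\mathbf P)$ at $\lambda$ are the eigenvalues of the monodromy matrix $\mathbb F(T;\lambda)$, where $\mathbb F(\cdot;\lambda)$ is the $2\times2$ fundamental solution matrix, with $\mathbb F(0;\lambda)=\mathbb I$, of the first-order system for $(p,p')^{\mathsf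 T}$ equivalent to $(\mathbf P)$. Proposition. There exists a strictly positive real temporal eigenvalue $\lambda_*>0$ such that at least one of the Floquet multipliers of $(\mathbf P)$ at $\lambda_*$ is equal to $1$ (so $\lambda_*$ is a periodic eigenvalue), and none of them is equal to $-1$ (so $\lambda_*$ is not an antiperiodic eigenvalue). -/

import Mathlib

namespace SineGordon

/-- `f` is (the profile of) a traveling wave of speed `c` of the sine-Gordon equation:
a real solution on the whole line of the pendulum equation `(c² - 1) f'' + sin f = 0`. -/
structure IsTravelingWave (c : ℝ) (f : ℝ → ℝ) : Prop where
  differentiable : Differentiable ℝ f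
  differentiable_deriv : Differentiable ℝ (deriv f)
  pendulum : ∀ z : ℝ, (c ^ 2 - 1) * deriv (deriv f) z + Real.sin (f z) = 0

/-- The total energy `½ (c² - 1) v² + 1 - cos u` at the point `(u, v) = (f, f')` of the
phase plane of the pendulum equation. -/
noncomputable def phaseEnergy (c : ℝ) (u v : ℝ) : ℝ :=
  (1 / 2) * (c ^ 2 - 1) * v ^ 2 + 1 - Real.cos u

/-- The part of the phase plane filled by the closed orbits inside the separatrix, `0 < E < 2`.
For `c² < 1` the separatrix is the level set `E = 0` and the enclosed equilibria have `E = 2`;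
for `c² > 1` the separatrix is the level set `E = 2` and the enclosed equilibria have `E = 0`. -/
def insideSeparatrix (c : ℝ) : Set (ℝ × ℝ) :=
  {w | 0 < phaseEnergy c w.1 w.2 ∧ phaseEnergy c w.1 w.2 < 2}

/-- A librational wave: a traveling wave whose orbit in the phase plane lies inside the
separatrix (and is not an equilibrium). -/
structure IsLibrationalWave (c : ℝ) (f : ℝ → ℝ) : Prop extends IsTravelingWave c f where
  orbit_inside : ∀ z : ℝ, (f z, deriv f z) ∈ insideSeparatrix c

/-- A subluminal librational wave: one of speed `c` with `c² < 1`. -/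
structure IsSubluminalLibrationalWave (c : ℝ) (f : ℝ → ℝ) : Prop
    extends IsLibrationalWave c f where
  subluminal : c ^ 2 < 1

/-- `T` is the fundamental period of `f`: the smallest positive number such that
`f (z + T) = f z` modulo `2π` for all `z`. -/
def IsFundamentalPeriod (f : ℝ → ℝ) (T : ℝ) : Prop :=
  IsLeast {S : ℝ | 0 < S ∧ ∀ z : ℝ, ∃ k : ℤ, f (z + S) = f z + 2 * Real.pi * k} T

/-- `γ = 1 / (c² - 1)`. -/
noncomputable def gam (c : ℝ) : ℝ := 1 / (c ^ 2 - 1)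

/-- `p` solves the spectral problem
`p'' - 2 c γ lam p' + γ (lam² + cos f) p = 0` on the whole line. -/
structure SolvesP (c : ℝ) (f : ℝ → ℝ) (lam : ℂ) (p : ℝ → ℂ) : Prop where
  differentiable : Differentiable ℝ p
  differentiable_deriv : Differentiable ℝ (deriv p)
  equation : ∀ z : ℝ,
    deriv (deriv p) z - 2 * (c : ℂ) * (gam c : ℂ) * lam * deriv p z
      + (gam c : ℂ) * (lam ^ 2 + (Real.cos (f z) : ℂ)) * p z = 0

/-- The spectrum: the set of temporal eigenvalues, i.e. of those `lam` for which the spectral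
problem has a nontrivial solution that is bounded on the whole line. -/
def temporalSpectrum (c : ℝ) (f : ℝ → ℝ) : Set ℂ :=
  {lam | ∃ p : ℝ → ℂ, SolvesP c f lam p ∧ p ≠ 0 ∧ ∃ B : ℝ, ∀ z : ℝ, ‖p z‖ ≤ B}

/-- The coefficient matrix of the first-order system for `(p, p')`. -/
noncomputable def coeffMatrix (c : ℝ) (f : ℝ → ℝ) (lam : ℂ) (z : ℝ) :
    Matrix (Fin 2) (Fin 2) ℂ :=
  !![0, 1;
    -(gam c : ℂ) * (lam ^ 2 + (Real.cos (f z) : ℂ)), 2 * (c : ℂ) * (gam c : ℂ) * lam]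

/-- `F` is the fundamental solution matrix of `F' = A F` with `F 0 = 1`. -/
structure IsFundamentalMatrix (A F : ℝ → Matrix (Fin 2) (Fin 2) ℂ) : Prop where
  initial : F 0 = 1
  hasDerivAt : ∀ (z : ℝ) (i j : Fin 2),
    HasDerivAt (fun x : ℝ => F x i j) ((A z * F z) i j) z

/-- `M` is the monodromy matrix `F T` of the spectral problem, for the period `T`. -/
def IsMonodromyMatrix (c : ℝ) (f : ℝ → ℝ) (T : ℝ) (lam : ℂ)
    (M : Matrix (Fin 2) (Fin 2) ℂ) : Prop :=
  ∃ F : ℝ → Matrix (Fin 2) (Fin 2) ℂ,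
    IsFundamentalMatrix (coeffMatrix c f lam) F ∧ F T = M

/-- `ρ` is a Floquet multiplier of the spectral problem at `lam`: an eigenvalue of the
monodromy matrix. -/
def IsFloquetMultiplier (c : ℝ) (f : ℝ → ℝ) (T : ℝ) (lam ρ : ℂ) : Prop :=
  ∃ M : Matrix (Fin 2) (Fin 2) ℂ,
    IsMonodromyMatrix c f T lam M ∧ Module.End.HasEigenvalue (Matrix.toLin' M) ρ

end SineGordon

/-! The wave librates about an odd multiple of `π`. With `S` half its fundamental period, reflection
symmetry makes `f'` antiperiodic and `cos f` periodic under translation by `S`. The spectral problem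
therefore already has a monodromy matrix `M(lam) = F S` over the half period, and the full monodromy
matrix is `M ^ 2`. For real `lam`, `M` is real with determinant `δ = exp (2 c γ lam S)`, and it has
eigenvalue `1` exactly when `1 + δ - tr M = 0`. At `lam = 0`, `f'` is an antiperiodic solution, so
`M` has eigenvalue `-1` and determinant `1`; hence `tr M = -2` and the expression is `4`
(`trace_eq_neg_two`). At `lam = 1` the potential is nonnegative, solutions do not oscillate, and the
expression is at most `0` (`one_add_exp_le_trace`). The intermediate value theorem gives a zero in
`(0, 1]`. There `M` has eigenvalues `1` and `δ > 0`, so `M ^ 2` has eigenvalues `1` and `δ ^ 2`,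
neither equal to `-1`. -/

namespace SineGordon
open MeasureTheory Set Filter Topology

/-! ### Linear equations in a Banach algebra: existence and dependence on parameters -/

section LinearODE

variable {R : Type*} [NormedRing R] [NormedAlgebra ℝ R]

/-- The Neumann iterates of the linear equation `F' = A F`, `F 0 = 1`. -/
noncomputable def neumannIterate (A : ℝ → R) : ℕ → ℝ → R
  | 0 => fun _ => 1
  | n + 1 => fun z => ∫ t in (0 : ℝ)..z, A t * neumannIterate A n t

theorem norm_neumannIterate_le {A : ℝ → R} {K : ℝ}
    (hK : ∀ z, ‖A z‖ ≤ K) (n : ℕ) (z : ℝ) :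
    ‖neumannIterate A n z‖ ≤ ‖(1 : R)‖ * ((K * |z|) ^ n / n.factorial) := by
  have hK0 : 0 ≤ K := (norm_nonneg _).trans (hK 0)
  induction n generalizing z with
  | zero => simp [neumannIterate]
  | succ n ih =>
    have hc : Continuous fun t : ℝ => K * (‖(1 : R)‖ * ((K * |t|) ^ n / n.factorial)) := by
      fun_prop
    calc ‖neumannIterate A (n + 1) z‖
        ≤ |∫ t in (0 : ℝ)..z, K * (‖(1 : R)‖ * ((K * |t|) ^ n / n.factorial))| := by
          refine intervalIntegral.norm_integral_le_abs_of_norm_le (.of_forall fun t => ?_)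
            (hc.intervalIntegrable _ _)
          exact (norm_mul_le _ _).trans (mul_le_mul (hK t) (ih t) (norm_nonneg _) hK0)
      _ = |∫ t in (0 : ℝ)..z,
            (K ^ (n + 1) * ‖(1 : R)‖ / n.factorial) * |t - 0| ^ n| := by
          congr 2; funext t; rw [sub_zero]; ring
      _ = ‖(1 : R)‖ * ((K * |z|) ^ (n + 1) / (n + 1).factorial) := by
          rw [intervalIntegral.abs_intervalIntegral_eq, integral_const_mul,
            integral_pow_abs_sub_uIoc, abs_of_nonneg (by positivity), sub_zero, mul_pow,
            Nat.factorial_succ]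
          push_cast
          field_simp

variable [CompleteSpace R]

theorem hasDerivAt_neumannIterate_succ {A : ℝ → R} (hA : Continuous A) (n : ℕ)
    (hn : Continuous (neumannIterate A n)) (z : ℝ) :
    HasDerivAt (neumannIterate A (n + 1)) (A z * neumannIterate A n z) z :=
  intervalIntegral.integral_hasDerivAt_right ((hA.mul hn).intervalIntegrable _ _)
    ((hA.mul hn).stronglyMeasurableAtFilter _ _) (hA.mul hn).continuousAt

theorem continuous_neumannIterate {A : ℝ → R} (hA : Continuous A) (n : ℕ) :
    Continuous (neumannIterate A n) := by
  induction n with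
  | zero => exact continuous_const
  | succ n ih =>
    exact continuous_iff_continuousAt.2 fun z =>
      (hasDerivAt_neumannIterate_succ hA n ih z).continuousAt

theorem exists_fundamental_solution {A : ℝ → R} (hA : Continuous A) {K : ℝ}
    (hK : ∀ z, ‖A z‖ ≤ K) :
    ∃ F : ℝ → R, F 0 = 1 ∧ ∀ z, HasDerivAt F (A z * F z) z := by
  have hK0 : 0 ≤ K := (norm_nonneg _).trans (hK 0)
  have hs : ∀ r : ℝ, Summable fun n : ℕ => ‖(1 : R)‖ * ((K * r) ^ n / n.factorial) :=
    fun r => (Real.summable_pow_div_factorial _).mul_left _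
  have hsum : ∀ z, Summable fun n => neumannIterate A n z := fun z =>
    .of_norm_bounded (hs |z|) fun n => norm_neumannIterate_le hK n z
  have hz0 : ∀ n, neumannIterate A (n + 1) 0 = 0 := fun n => by simp [neumannIterate]
  have hF : ∀ z, ∑' n, neumannIterate A n z = 1 + ∑' n, neumannIterate A (n + 1) z := fun z => by
    rw [(hsum z).tsum_eq_zero_add]; rfl
  refine ⟨fun z => ∑' n, neumannIterate A n z, ?_, fun z => ?_⟩
  · simp [hF, hz0]
  · simp_rw [hF]
    rw [← hF, ← (hsum z).tsum_mul_left]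
    refine HasDerivAt.const_add _ ?_
    -- Termwise differentiation needs a summable bound that is uniform near `z`; the ball of radius
    -- `|z| + 1` contains `z` and supplies the exponential series at `K * (|z| + 1)`.
    refine hasDerivAt_tsum_of_isPreconnected (t := Metric.ball 0 (|z| + 1)) (y₀ := 0)
      ((hs (|z| + 1)).mul_left K) Metric.isOpen_ball
      (convex_ball _ _).isPreconnected
      (fun n y _ => hasDerivAt_neumannIterate_succ hA n (continuous_neumannIterate hA n) y)
      (fun n y hy => ?_) (by simp; positivity) (by simp [hz0]) (by simp)
    have hy' : |y| ≤ |z| + 1 := by simpa using (Metric.mem_ball.1 hy).le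
    refine (norm_mul_le _ _).trans (mul_le_mul (hK y) ?_ (norm_nonneg _) hK0)
    refine (norm_neumannIterate_le hK n y).trans ?_
    gcongr

/-- A family of periodic linear equations depending continuously on a compact parameter has
fundamental solutions depending continuously on the parameter. -/
theorem exists_fundamental_family {X : Type*} [TopologicalSpace X] [CompactSpace X]
    (A : C(ℝ × X, R)) {S : ℝ} (hS : S ≠ 0) (hper : ∀ z x, A (z + S, x) = A (z, x)) :
    ∃ F : X → ℝ → R, (∀ x, F x 0 = 1) ∧ (∀ x z, HasDerivAt (F x) (A (z, x) * F x z) z) ∧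
      ∀ z, Continuous fun x => F x z := by
  have hA : Function.Periodic A.curry S := fun z => ContinuousMap.ext fun x => hper z x
  -- Currying turns the family into one equation in the Banach algebra `C(X, R)`, so continuity in
  -- the parameter is built into the solution. Periodicity bounds the coefficient.
  obtain ⟨K, hK⟩ := (isBounded_iff_forall_norm_le (E := C(X, R))).1
    (Function.Periodic.isBounded_of_continuous hA hS A.curry.continuous)
  obtain ⟨G, hG0, hG⟩ := exists_fundamental_solution (R := C(X, R)) A.curry.continuous (K := K)
    fun z => hK _ (mem_range_self z)
  refine ⟨fun x z => G z x, fun x => by simp [hG0], fun x z => ?_, fun z => (G z).continuous⟩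
  have h : HasDerivAt (F := C(X, R)) G (A.curry z * G z) z := hG z
  exact ((ContinuousMap.evalCLM ℝ x : C(X, R) →L[ℝ] R).hasFDerivAt
    (x := G z)).comp_hasDerivAt z h

end LinearODE

/-- Uniqueness for the scalar second-order equation `r'' = q r + d r'`. -/
theorem second_order_unique {E : Type*} [NormedAddCommGroup E] [NormedSpace ℝ E]
    {q : ℝ → ℝ} {d Q : ℝ} (hq : ∀ z, |q z| ≤ Q) {r s r' s' : ℝ → E}
    (hr : ∀ z, HasDerivAt r (s z) z) (hs : ∀ z, HasDerivAt s (q z • r z + d • s z) z)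
    (hr' : ∀ z, HasDerivAt r' (s' z) z) (hs' : ∀ z, HasDerivAt s' (q z • r' z + d • s' z) z)
    (h0 : r 0 = r' 0) (h1 : s 0 = s' 0) : r = r' ∧ s = s' := by
  have hQ0 : 0 ≤ Q := (abs_nonneg _).trans (hq 0)
  have hlip : ∀ t, LipschitzOnWith (Real.toNNReal (1 + Q + |d|))
      (fun w : E × E => (w.2, q t • w.1 + d • w.2)) univ := by
    intro t
    refine LipschitzOnWith.of_dist_le_mul fun x _ y _ => ?_
    rw [Real.coe_toNNReal _ (by positivity), dist_eq_norm, dist_eq_norm]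
    have h1 : ‖x.1 - y.1‖ ≤ ‖x - y‖ := norm_fst_le (x - y)
    have h2 : ‖x.2 - y.2‖ ≤ ‖x - y‖ := norm_snd_le (x - y)
    have h3 : ‖x - y‖ * 0 ≤ ‖x - y‖ * |d| := by gcongr; positivity
    have h4 : ‖x - y‖ * 0 ≤ ‖x - y‖ * Q := by gcongr
    refine norm_prod_le_iff.2 ⟨?_, ?_⟩
    · simp only [Prod.fst_sub]; nlinarith
    · simp only [Prod.snd_sub]
      have : q t • x.1 + d • x.2 - (q t • y.1 + d • y.2)
          = q t • (x.1 - y.1) + d • (x.2 - y.2) := by module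
      rw [this]
      calc _ ≤ |q t| * ‖x.1 - y.1‖ + |d| * ‖x.2 - y.2‖ := by
            refine (norm_add_le _ _).trans ?_
            rw [norm_smul, norm_smul, Real.norm_eq_abs, Real.norm_eq_abs]
        _ ≤ Q * ‖x - y‖ + |d| * ‖x - y‖ := by gcongr; exact hq t
        _ ≤ _ := by nlinarith [norm_nonneg (x - y)]
  have := ODE_solution_unique_univ (t₀ := 0) (f := fun z => (r z, s z))
    (g := fun z => (r' z, s' z)) hlip (fun t => ⟨(hr t).prodMk (hs t), mem_univ _⟩)
    (fun t => ⟨(hr' t).prodMk (hs' t), mem_univ _⟩) (by simp [h0, h1])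
  constructor <;> funext z
  · exact congrArg Prod.fst (congrFun this z)
  · exact congrArg Prod.snd (congrFun this z)

/-! ### Librations of the pendulum and their half-period -/

/-- A librational motion of the pendulum `g'' = -a sin g`, with velocity `v` and reduced
energy `e ∈ (0, 2)`. -/
structure IsPendulumLibration (a e : ℝ) (g v : ℝ → ℝ) : Prop where
  a_pos : 0 < a
  e_pos : 0 < e
  e_lt : e < 2
  hasDerivAt : ∀ z, HasDerivAt g (v z) z
  hasDerivAt_vel : ∀ z, HasDerivAt v (-a * Real.sin (g z)) z
  energy : ∀ z, v z ^ 2 = 2 * a * (1 + Real.cos (g z) - e)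
  abs_lt_pi : ∀ z, |g z| < Real.pi

theorem exists_neg_of_deriv_le {u u' : ℝ → ℝ} {t σ : ℝ} (hσ : 0 < σ)
    (hu : ∀ z, HasDerivAt u (u' z) z) (h : ∀ z, t < z → u' z ≤ -σ) : ∃ z, t < z ∧ u z < 0 := by
  -- Over this length `u` drops by at least `|u t| + 1`, hence ends at or below `-1`.
  refine ⟨t + (|u t| + 1) / σ, by simp; positivity, ?_⟩
  have hb : t < t + (|u t| + 1) / σ := by simp; positivity
  obtain ⟨ξ, hξ, he⟩ := exists_hasDerivAt_eq_slope u u' hb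
    (fun z _ => (hu z).continuousAt.continuousWithinAt) (fun z _ => hu z)
  have h1 := h ξ hξ.1
  rw [he, div_le_iff₀ (by linarith)] at h1
  have h2 : -σ * (t + (|u t| + 1) / σ - t) = -(|u t| + 1) := by field_simp; ring
  have := le_abs_self (u t)
  linarith

namespace IsPendulumLibration

variable {a e : ℝ} {g v : ℝ → ℝ}

theorem neg (h : IsPendulumLibration a e g v) :
    IsPendulumLibration a e (fun z => -g z) (fun z => -v z) where
  a_pos := h.a_pos
  e_pos := h.e_pos
  e_lt := h.e_lt
  hasDerivAt z := (h.hasDerivAt z).neg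
  hasDerivAt_vel z := by simpa using (h.hasDerivAt_vel z).fun_neg
  energy z := by simpa using h.energy z
  abs_lt_pi z := by simpa using h.abs_lt_pi z

theorem continuous (h : IsPendulumLibration a e g v) : Continuous g :=
  continuous_iff_continuousAt.2 fun z => (h.hasDerivAt z).continuousAt

/-- If `g` stayed positive, `v` would be nonincreasing, and nonnegative because otherwise `g` would
fall below zero. Then `g` is nondecreasing, so it stays away from `0`, while the energy keeps it
away from `π`. The force is thus bounded away from zero and drives `v` negative, a contradiction. -/
theorem exists_nonpos (h : IsPendulumLibration a e g v) (t : ℝ) : ∃ z, t < z ∧ g z ≤ 0 := by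
  by_contra! hpos
  have hsin : ∀ z, t < z → 0 ≤ Real.sin (g z) := fun z hz =>
    Real.sin_nonneg_of_nonneg_of_le_pi (hpos z hz).le (abs_lt.1 (h.abs_lt_pi z)).2.le
  have hanti : AntitoneOn v (Ioi t) := antitoneOn_of_deriv_nonpos (convex_Ioi t)
    (fun z _ => (h.hasDerivAt_vel z).continuousAt.continuousWithinAt)
    (fun z _ => (h.hasDerivAt_vel z).differentiableAt.differentiableWithinAt) (fun z hz => by
      rw [interior_Ioi] at hz
      rw [(h.hasDerivAt_vel z).deriv]
      have := mul_nonneg h.a_pos.le (hsin z hz)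
      linarith)
  have hv : ∀ z, t < z → 0 ≤ v z := by
    intro z hz
    by_contra! hneg
    obtain ⟨y, hy, hy0⟩ := exists_neg_of_deriv_le (t := z) (σ := -v z) (by linarith)
      h.hasDerivAt (fun y hy => by
        have := hanti (mem_Ioi.2 hz) (mem_Ioi.2 (hz.trans hy)) hy.le
        linarith)
    exact absurd hy0 (not_lt.2 (hpos y (hz.trans hy)).le)
  have hmono : MonotoneOn g (Ioi t) := monotoneOn_of_deriv_nonneg (convex_Ioi t)
    (fun z _ => (h.hasDerivAt z).continuousAt.continuousWithinAt)
    (fun z _ => (h.hasDerivAt z).differentiableAt.differentiableWithinAt) (fun z hz => by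
      rw [interior_Ioi] at hz
      rw [(h.hasDerivAt z).deriv]
      exact hv z hz)
  set δ := g (t + 1) with hδ
  have ht1 : t < t + 1 := by linarith
  have hδ0 : 0 < δ := hpos _ ht1
  have hcos : Real.cos δ < 1 := by
    rw [← Real.cos_zero]
    exact Real.cos_lt_cos_of_nonneg_of_le_pi le_rfl (abs_lt.1 (h.abs_lt_pi _)).2.le hδ0
  obtain ⟨y, hy, hy0⟩ := exists_neg_of_deriv_le (t := t + 1)
    (σ := a * (e * (1 - Real.cos δ))) (mul_pos h.a_pos (mul_pos h.e_pos (by linarith)))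
    h.hasDerivAt_vel (fun z hz => by
      have hle : δ ≤ g z := hmono (mem_Ioi.2 ht1) (mem_Ioi.2 (ht1.trans hz)) hz.le
      have hc : Real.cos (g z) ≤ Real.cos δ :=
        Real.cos_le_cos_of_nonneg_of_le_pi hδ0.le (abs_lt.1 (h.abs_lt_pi z)).2.le hle
      have he : e ≤ 1 + Real.cos (g z) := by
        have := h.energy z
        by_contra! hlt
        have : 2 * a * (1 + Real.cos (g z) - e) < 0 :=
          mul_neg_of_pos_of_neg (by linarith [h.a_pos]) (by linarith)
        nlinarith [sq_nonneg (v z)]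
      have hs := hsin z (ht1.trans hz)
      have hs1 := Real.sin_le_one (g z)
      have hs2 := Real.sin_sq_add_cos_sq (g z)
      have hprod : e * (1 - Real.cos δ) ≤ (1 + Real.cos (g z)) * (1 - Real.cos (g z)) :=
        mul_le_mul he (by linarith) (by linarith) (by linarith [h.e_pos])
      -- The product bounds `sin ^ 2` from below, and `sin ^ 2 ≤ sin` because `0 ≤ sin ≤ 1`.
      have : e * (1 - Real.cos δ) ≤ Real.sin (g z) := by nlinarith
      have := mul_le_mul_of_nonneg_left this h.a_pos.le
      linarith)
  exact absurd hy0 (not_lt.2 (hv y (ht1.trans hy)))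

theorem exists_zero (h : IsPendulumLibration a e g v) (t : ℝ) : ∃ z, t < z ∧ g z = 0 := by
  obtain ⟨x, hx, hx0⟩ := h.exists_nonpos t
  obtain ⟨y, hy, hy0⟩ := h.neg.exists_nonpos x
  obtain ⟨z, hz, hz0⟩ := intermediate_value_Icc hy.le h.continuous.continuousOn
    ⟨hx0, by simpa using hy0⟩
  exact ⟨z, hx.trans_le hz.1, hz0⟩

theorem vel_ne_zero (h : IsPendulumLibration a e g v) {z : ℝ} (hz : g z = 0) : v z ≠ 0 := by
  intro h0
  have := h.energy z
  rw [h0, hz, Real.cos_zero] at this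
  have : 0 < 2 * a * (1 + 1 - e) := mul_pos (by linarith [h.a_pos]) (by linarith [h.e_lt])
  linarith

theorem unique {g' v' : ℝ → ℝ} (h : IsPendulumLibration a e g v)
    (h' : IsPendulumLibration a e g' v') {x y : ℝ} (hg : g x = g' y) (hv : v x = v' y) (z : ℝ) :
    g (x + z) = g' (y + z) := by
  have hlip : ∀ _ : ℝ, LipschitzOnWith (Real.toNNReal (1 + a))
      (fun w : ℝ × ℝ => (w.2, -a * Real.sin w.1)) univ := by
    intro _
    refine LipschitzOnWith.of_dist_le_mul fun x _ y _ => ?_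
    have ha := h.a_pos
    rw [Real.coe_toNNReal _ (by positivity), dist_eq_norm, dist_eq_norm]
    have h1 : ‖x.1 - y.1‖ ≤ ‖x - y‖ := norm_fst_le (x - y)
    have h2 : ‖x.2 - y.2‖ ≤ ‖x - y‖ := norm_snd_le (x - y)
    have h3 : 0 ≤ a * ‖x - y‖ := by positivity
    refine norm_prod_le_iff.2 ⟨?_, ?_⟩
    · simp only [Prod.fst_sub]; nlinarith
    · simp only [Prod.snd_sub]
      rw [← mul_sub, norm_mul, norm_neg, Real.norm_of_nonneg ha.le]
      have h4 : ‖Real.sin x.1 - Real.sin y.1‖ ≤ ‖x.1 - y.1‖ := by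
        simpa [Real.dist_eq] using Real.lipschitzWith_sin.dist_le_mul x.1 y.1
      calc _ ≤ a * ‖x - y‖ := by gcongr; exact h4.trans h1
        _ ≤ _ := by nlinarith [norm_nonneg (x - y)]
  have := ODE_solution_unique_univ (t₀ := 0) (f := fun z => (g (x + z), v (x + z)))
    (g := fun z => (g' (y + z), v' (y + z))) hlip
    (fun t => ⟨((h.hasDerivAt (x + t)).comp_const_add x t).prodMk
      ((h.hasDerivAt_vel (x + t)).comp_const_add x t), mem_univ _⟩)
    (fun t => ⟨((h'.hasDerivAt (y + t)).comp_const_add y t).prodMk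
      ((h'.hasDerivAt_vel (y + t)).comp_const_add y t), mem_univ _⟩) (by simp [hg, hv])
  exact congrArg Prod.fst (congrFun this z)

/-- The velocity does not vanish at a zero, so zeros are isolated; those beyond a punctured
neighbourhood form a nonempty closed set, whose least element is the next zero. -/
theorem exists_next_zero (h : IsPendulumLibration a e g v) {x : ℝ} (hx : g x = 0) :
    ∃ y, x < y ∧ g y = 0 ∧ ∀ z ∈ Ioo x y, g z ≠ 0 := by
  have hne := (h.hasDerivAt x).eventually_ne (c := 0) (h.vel_ne_zero hx)
  obtain ⟨ε, hε, hb⟩ := Metric.mem_nhdsWithin_iff.1 hne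
  have hnear : ∀ z, x < z → z < x + ε → g z ≠ 0 := fun z h1 h2 =>
    hb ⟨by rw [Metric.mem_ball, Real.dist_eq, abs_lt]; constructor <;> linarith, ne_of_gt h1⟩
  have hcl : IsClosed {z | x + ε ≤ z ∧ g z = 0} :=
    (isClosed_le continuous_const continuous_id).inter (isClosed_eq h.continuous continuous_const)
  obtain ⟨w, hw, hw0⟩ := h.exists_zero (x + ε)
  obtain ⟨hmem, hle⟩ := hcl.isLeast_csInf ⟨w, hw.le, hw0⟩ ⟨x + ε, fun z hz => hz.1⟩
  refine ⟨_, lt_of_lt_of_le (by linarith) hmem.1, hmem.2, fun z hz h0 => ?_⟩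
  rcases lt_or_ge z (x + ε) with h1 | h1
  · exact hnear z hz.1 h1 h0
  · exact absurd (hle ⟨h1, h0⟩) (not_le.2 hz.2)

/-- The velocities at consecutive zeros do not have the same positive value. -/
theorem vel_ne_of_pos (h : IsPendulumLibration a e g v) {x y : ℝ} (hxy : x < y) (hx : g x = 0)
    (hy : g y = 0) (hne : ∀ z ∈ Ioo x y, g z ≠ 0) (hv : 0 < v x) : ¬ 0 < v y := by
  intro hvy
  have h1 : ∀ᶠ z in 𝓝[>] x, 0 < g z := by
    have := (hasDerivWithinAt_iff_tendsto_slope' (s := Ioi x) (by simp)).1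
      (h.hasDerivAt x).hasDerivWithinAt
    filter_upwards [this.eventually (lt_mem_nhds hv), self_mem_nhdsWithin] with z hz hxz
    rw [slope_def_field, hx, sub_zero] at hz
    exact (div_pos_iff_of_pos_right (sub_pos.2 hxz)).1 hz
  have h2 : ∀ᶠ z in 𝓝[<] y, g z < 0 := by
    have := (hasDerivWithinAt_iff_tendsto_slope' (s := Iio y) (by simp)).1
      (h.hasDerivAt y).hasDerivWithinAt
    filter_upwards [this.eventually (lt_mem_nhds hvy), self_mem_nhdsWithin] with z hz hzy
    rw [slope_def_field, hy, sub_zero] at hz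
    have : z - y < 0 := sub_neg.2 hzy
    by_contra! hc
    exact absurd hz (not_lt.2 (div_nonpos_of_nonneg_of_nonpos hc this.le))
  obtain ⟨p, hp, hpx⟩ := (h1.and (Ioo_mem_nhdsGT hxy)).exists
  obtain ⟨r, hr, hry⟩ := (h2.and (Ioo_mem_nhdsLT hpx.2)).exists
  obtain ⟨z, hz, hz0⟩ := intermediate_value_Icc' hry.1.le h.continuous.continuousOn
    ⟨hr.le, hp.le⟩
  exact hne z ⟨hpx.1.trans_le hz.1, hz.2.trans_lt hry.2⟩ hz0

/-- Energy conservation fixes the speed at a zero, and equal signs would force another zero in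
between. -/
theorem vel_eq_neg (h : IsPendulumLibration a e g v) {x y : ℝ} (hxy : x < y) (hx : g x = 0)
    (hy : g y = 0) (hne : ∀ z ∈ Ioo x y, g z ≠ 0) : v y = -v x := by
  have hsq : v y ^ 2 = v x ^ 2 := by rw [h.energy, h.energy, hx, hy]
  rcases sq_eq_sq_iff_eq_or_eq_neg.1 hsq with heq | heq
  · exfalso
    rcases lt_or_gt_of_ne (h.vel_ne_zero hx) with hlt | hgt
    · exact h.neg.vel_ne_of_pos hxy (by simp [hx]) (by simp [hy]) (by simpa using hne)
        (by simpa using hlt) (by simpa [heq] using hlt)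
    · exact h.vel_ne_of_pos hxy hx hy hne hgt (by rwa [heq])
  · exact heq

/-- A librational motion has a half-period `S`, and `2 S` is its least period. -/
theorem exists_half_period (h : IsPendulumLibration a e g v) :
    ∃ S, 0 < S ∧ (∀ z, g (z + S) = -g z) ∧
      ∀ T, 0 < T → (∀ z, g (z + T) = g z) → 2 * S ≤ T := by
  obtain ⟨x, -, hx⟩ := h.exists_zero 0
  obtain ⟨y, hxy, hy, hne⟩ := h.exists_next_zero hx
  have hv := h.vel_eq_neg hxy hx hy hne
  -- `g` started at `y` and `-g` started at `x` have the same initial data and solve the same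
  -- autonomous equation.
  have hS : ∀ z, g (z + (y - x)) = -g z := fun z => by
    have := h.unique h.neg (x := y) (y := x) (by simp [hx, hy]) hv (z - x)
    simpa [add_sub_left_comm, add_comm] using this
  refine ⟨y - x, by linarith, hS, fun T hT hper => ?_⟩
  by_contra! hlt
  have hxT : g (x + T) = 0 := by rw [hper, hx]
  -- A shorter period puts a zero strictly between `x` and `y`, directly or after shifting back by
  -- the half-period; `T = y - x` fails because the velocity changes sign.
  rcases lt_trichotomy T (y - x) with h1 | h1 | h1
  · exact hne (x + T) ⟨by linarith, by linarith⟩ hxT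
  · have hD : HasDerivAt g (v (x + T)) x := by
      have := (h.hasDerivAt (x + T)).comp_add_const x T
      rwa [funext hper] at this
    have h2 := hD.unique (h.hasDerivAt x)
    rw [h1, add_sub_cancel, hv] at h2
    exact h.vel_ne_zero hx (by linarith)
  · refine hne (x + T - (y - x)) ⟨by linarith, by linarith⟩ ?_
    have := hS (x + T - (y - x))
    rw [sub_add_cancel, hxT] at this
    linarith

end IsPendulumLibration

/-! ### Real second-order equations: determinant, trace bound and parameter dependence -/

/-- `F` is the fundamental matrix of the real second-order equation `r'' = q r + d r'`. -/
structure IsSecondOrderFundamental (q : ℝ → ℝ) (d : ℝ) (F : ℝ → Matrix (Fin 2) (Fin 2) ℝ) :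
    Prop where
  initial : F 0 = 1
  hasDerivAt_zero : ∀ z j, HasDerivAt (fun x => F x 0 j) (F z 1 j) z
  hasDerivAt_one : ∀ z j, HasDerivAt (fun x => F x 1 j) (q z * F z 0 j + d * F z 1 j) z

/-- The integrating factor gives `(exp (-d z) s)' = exp (-d z) q r ≥ 0`, so `s` stays nonnegative
and `r` is nondecreasing. -/
theorem le_of_nonneg_Ioo {q r s : ℝ → ℝ} {d t : ℝ} (hq : ∀ z, 0 ≤ q z)
    (hr : ∀ z, HasDerivAt r (s z) z) (hs : ∀ z, HasDerivAt s (q z * r z + d * s z) z)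
    (h1 : 0 ≤ s 0) (ht : 0 ≤ t) (hpos : ∀ z ∈ Ioo 0 t, 0 ≤ r z) :
    r 0 ≤ r t ∧ s 0 ≤ Real.exp (-(d * t)) * s t := by
  have hw : ∀ z, HasDerivAt (fun x => Real.exp (-(d * x)) * s x)
      (Real.exp (-(d * z)) * (q z * r z)) z := fun z => by
    have he : HasDerivAt (fun x => Real.exp (-(d * x))) (Real.exp (-(d * z)) * (-(d * 1))) z :=
      ((hasDerivAt_id z).const_mul d).fun_neg.exp
    exact (he.fun_mul (hs z)).congr_deriv (by ring)
  have hmono : MonotoneOn (fun x => Real.exp (-(d * x)) * s x) (Icc 0 t) :=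
    monotoneOn_of_deriv_nonneg (convex_Icc _ _)
      (fun z _ => (hw z).continuousAt.continuousWithinAt)
      (fun z _ => (hw z).differentiableAt.differentiableWithinAt) (fun z hz => by
        rw [interior_Icc] at hz
        rw [(hw z).deriv]
        have := hq z
        have := hpos z hz
        positivity)
  have hle : ∀ z ∈ Icc 0 t, s 0 ≤ Real.exp (-(d * z)) * s z := fun z hz => by
    simpa using hmono (left_mem_Icc.2 ht) hz hz.1
  refine ⟨?_, hle t (right_mem_Icc.2 ht)⟩
  refine monotoneOn_of_deriv_nonneg (convex_Icc 0 t)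
    (fun z _ => (hr z).continuousAt.continuousWithinAt)
    (fun z _ => (hr z).differentiableAt.differentiableWithinAt) (fun z hz => ?_)
    (left_mem_Icc.2 ht) (right_mem_Icc.2 ht) ht
  rw [interior_Icc] at hz
  rw [(hr z).deriv]
  exact nonneg_of_mul_nonneg_right (h1.trans (hle z ⟨hz.1.le, hz.2.le⟩)) (Real.exp_pos _)

/-- At a first point where `r ≤ 0` the preceding lemma would still give `r ≥ r 0 > 0`, so the sign
assumption on `r` is automatic. -/
theorem le_of_pos_initial {q r s : ℝ → ℝ} {d t : ℝ} (hq : ∀ z, 0 ≤ q z)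
    (hr : ∀ z, HasDerivAt r (s z) z) (hs : ∀ z, HasDerivAt s (q z * r z + d * s z) z)
    (h0 : 0 < r 0) (h1 : 0 ≤ s 0) (ht : 0 ≤ t) :
    r 0 ≤ r t ∧ s 0 ≤ Real.exp (-(d * t)) * s t := by
  have hc : Continuous r := continuous_iff_continuousAt.2 fun z => (hr z).continuousAt
  refine le_of_nonneg_Ioo hq hr hs h1 ht fun z hz => ?_
  by_contra! hneg
  have hcl : IsClosed {x | 0 ≤ x ∧ r x ≤ 0} :=
    (isClosed_le continuous_const continuous_id).inter (isClosed_le hc continuous_const)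
  obtain ⟨hmem, hle⟩ := hcl.isLeast_csInf ⟨z, hz.1.le, hneg.le⟩ ⟨0, fun x hx => hx.1⟩
  have := (le_of_nonneg_Ioo hq hr hs h1 hmem.1 fun x hx => by
    by_contra! hx0
    exact absurd (hle ⟨hx.1.le, hx0.le⟩) (not_le.2 hx.2)).1
  linarith [hmem.2]

namespace IsSecondOrderFundamental

variable {q : ℝ → ℝ} {d Q : ℝ} {F : ℝ → Matrix (Fin 2) (Fin 2) ℝ}

theorem det_eq (h : IsSecondOrderFundamental q d F) (z : ℝ) :
    F z 0 0 * F z 1 1 - F z 0 1 * F z 1 0 = Real.exp (d * z) := by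
  have hw : ∀ z, HasDerivAt
      (fun x => Real.exp (-(d * x)) * (F x 0 0 * F x 1 1 - F x 0 1 * F x 1 0)) 0 z := fun z => by
    have he : HasDerivAt (fun x => Real.exp (-(d * x))) (Real.exp (-(d * z)) * (-(d * 1))) z :=
      ((hasDerivAt_id z).const_mul d).fun_neg.exp
    exact (he.fun_mul (((h.hasDerivAt_zero z 0).fun_mul (h.hasDerivAt_one z 1)).fun_sub
      ((h.hasDerivAt_zero z 1).fun_mul (h.hasDerivAt_one z 0)))).congr_deriv (by ring)
  have := is_const_of_deriv_eq_zero (fun z => (hw z).differentiableAt) (fun z => (hw z).deriv) z 0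
  simp only [h.initial, mul_zero, neg_zero, Real.exp_zero, Matrix.one_apply] at this
  rw [Real.exp_neg, inv_mul_eq_iff_eq_mul₀ (Real.exp_ne_zero _)] at this
  simpa using this

theorem eq_comb (h : IsSecondOrderFundamental q d F) (hq : ∀ z, |q z| ≤ Q) {r s : ℝ → ℝ}
    (hr : ∀ z, HasDerivAt r (s z) z) (hs : ∀ z, HasDerivAt s (q z * r z + d * s z) z) (z : ℝ) :
    r z = F z 0 0 * r 0 + F z 0 1 * s 0 ∧ s z = F z 1 0 * r 0 + F z 1 1 * s 0 := by
  have := second_order_unique (d := d) hq hr (by simpa using hs)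
    (r' := fun z => F z 0 0 * r 0 + F z 0 1 * s 0) (s' := fun z => F z 1 0 * r 0 + F z 1 1 * s 0)
    (fun z => ((h.hasDerivAt_zero z 0).mul_const _).add ((h.hasDerivAt_zero z 1).mul_const _))
    (fun z => by
      refine (((h.hasDerivAt_one z 0).mul_const (r 0)).fun_add
        ((h.hasDerivAt_one z 1).mul_const (s 0))).congr_deriv ?_
      simp only [smul_eq_mul]
      ring) (by simp [h.initial]) (by simp [h.initial])
  exact ⟨congrFun this.1 z, congrFun this.2 z⟩

theorem add_period (h : IsSecondOrderFundamental q d F) (hq : ∀ z, |q z| ≤ Q) {S : ℝ}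
    (hS : ∀ z, q (z + S) = q z) (z : ℝ) : F (z + S) = F z * F S := by
  have key : ∀ j, F (z + S) 0 j = F z 0 0 * F S 0 j + F z 0 1 * F S 1 j ∧
      F (z + S) 1 j = F z 1 0 * F S 0 j + F z 1 1 * F S 1 j := fun j => by
    have := h.eq_comb hq (r := fun z => F (z + S) 0 j) (s := fun z => F (z + S) 1 j)
      (fun z => (h.hasDerivAt_zero (z + S) j).comp_add_const z S)
      (fun z => by
        have := (h.hasDerivAt_one (z + S) j).comp_add_const z S
        rwa [hS] at this) z
    simpa using this
  ext i j
  fin_cases i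
  · simpa [Matrix.mul_apply] using (key j).1
  · simpa [Matrix.mul_apply] using (key j).2

theorem one_add_exp_le_trace (h : IsSecondOrderFundamental q d F) (hq : ∀ z, 0 ≤ q z) {S : ℝ}
    (hS : 0 ≤ S) : 1 + Real.exp (d * S) ≤ F S 0 0 + F S 1 1 := by
  have h1 : 1 ≤ F S 0 0 := by
    simpa [h.initial] using (le_of_pos_initial hq (fun z => h.hasDerivAt_zero z 0)
      (fun z => h.hasDerivAt_one z 0) (by simp [h.initial]) (by simp [h.initial]) hS).1
  -- The second column starts at `r 0 = 0`, where strict positivity fails; adding `ε` times the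
  -- first column repairs this, and then `ε → 0`.
  have h2 : ∀ ε : ℝ, 0 < ε → 1 ≤ Real.exp (-(d * S)) * (F S 1 1 + ε * F S 1 0) := fun ε hε => by
    have := (le_of_pos_initial (r := fun z => F z 0 1 + ε * F z 0 0)
      (s := fun z => F z 1 1 + ε * F z 1 0) hq
      (fun z => (h.hasDerivAt_zero z 1).add ((h.hasDerivAt_zero z 0).const_mul ε))
      (fun z => by
        exact ((h.hasDerivAt_one z 1).fun_add
          ((h.hasDerivAt_one z 0).const_mul ε)).congr_deriv (by ring)) (by simpa [h.initial]) (by simp [h.initial]) hS).2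
    simpa [h.initial] using this
  have h3 : 1 ≤ Real.exp (-(d * S)) * F S 1 1 := by
    have ht : Tendsto (fun ε : ℝ => Real.exp (-(d * S)) * (F S 1 1 + ε * F S 1 0)) (𝓝[>] 0)
        (𝓝 (Real.exp (-(d * S)) * (F S 1 1 + 0 * F S 1 0))) :=
      tendsto_nhdsWithin_of_tendsto_nhds
        (Continuous.tendsto (f := fun ε : ℝ => Real.exp (-(d * S)) * (F S 1 1 + ε * F S 1 0))
          (by fun_prop) 0)
    rw [zero_mul, add_zero] at ht
    exact ge_of_tendsto ht (eventually_nhdsWithin_of_forall fun ε hε => h2 ε hε)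
  rw [Real.exp_neg, inv_mul_eq_div, one_le_div (Real.exp_pos _)] at h3
  linarith

end IsSecondOrderFundamental

/-- Fundamental matrices of a family of second-order equations with coefficients that are
continuous in the parameter and bounded depend continuously on the parameter. -/
theorem exists_secondOrderFundamental_family {q : unitInterval → ℝ → ℝ} {d : unitInterval → ℝ}
    (hq : Continuous (Function.uncurry q)) (hd : Continuous d) {S : ℝ} (hS : S ≠ 0)
    (hper : ∀ l z, q l (z + S) = q l z) :
    ∃ F : unitInterval → ℝ → Matrix (Fin 2) (Fin 2) ℝ,
      (∀ l, IsSecondOrderFundamental (q l) (d l) (F l)) ∧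
        ∀ z i j, Continuous fun l => F l z i j := by
  let P : ℝ × ℝ →L[ℝ] ℝ × ℝ := .comp (.inl ℝ ℝ ℝ) (.snd ℝ ℝ ℝ)
  let P₀ : ℝ × ℝ →L[ℝ] ℝ × ℝ := .comp (.inr ℝ ℝ ℝ) (.fst ℝ ℝ ℝ)
  let P₁ : ℝ × ℝ →L[ℝ] ℝ × ℝ := .comp (.inr ℝ ℝ ℝ) (.snd ℝ ℝ ℝ)
  let B : C(ℝ × unitInterval, ℝ × ℝ →L[ℝ] ℝ × ℝ) :=
    ⟨fun w => P + q w.2 w.1 • P₀ + d w.2 • P₁, by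
      have : Continuous fun w : ℝ × unitInterval => q w.2 w.1 := hq.comp continuous_swap
      fun_prop⟩
  obtain ⟨G, hG0, hG, hGc⟩ := exists_fundamental_family B hS fun z l => by
    change P + q l (z + S) • P₀ + d l • P₁ = P + q l z • P₀ + d l • P₁
    rw [hper]
  have hvec : ∀ l z w, HasDerivAt (fun x => G l x w) (B (z, l) (G l z w)) z := fun l z w => by
    simpa using (hG l z).clm_apply (hasDerivAt_const z w)
  have hBv : ∀ l z w, B (z, l) w = (w.2, q l z * w.1 + d l * w.2) := fun l z w => by
    simp [B, P, P₀, P₁]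
  let b : Fin 2 → ℝ × ℝ := ![(1, 0), (0, 1)]
  have hfst : ∀ l z w, HasDerivAt (fun x => (G l x w).1) (G l z w).2 z := fun l z w => by
    have := (ContinuousLinearMap.fst ℝ ℝ ℝ).hasFDerivAt.comp_hasDerivAt z (hvec l z w)
    rwa [hBv] at this
  have hsnd : ∀ l z w, HasDerivAt (fun x => (G l x w).2)
      (q l z * (G l z w).1 + d l * (G l z w).2) z := fun l z w => by
    have := (ContinuousLinearMap.snd ℝ ℝ ℝ).hasFDerivAt.comp_hasDerivAt z (hvec l z w)
    rwa [hBv] at this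
  refine ⟨fun l z => .of fun i j => ![(G l z (b j)).1, (G l z (b j)).2] i,
    fun l => ⟨?_, fun z j => ?_, fun z j => ?_⟩, fun z i j => ?_⟩
  · ext i j
    fin_cases i <;> fin_cases j <;> simp [hG0, b]
  · simpa using hfst l z (b j)
  · simpa using hsnd l z (b j)
  · have := ((hGc z).clm_apply (continuous_const (y := b j)))
    fin_cases i
    · simpa using this.fst
    · simpa using this.snd

/-! ### From the wave to the pendulum -/

theorem IsSubluminalLibrationalWave.gam_neg {c : ℝ} {f : ℝ → ℝ}
    (hf : IsSubluminalLibrationalWave c f) : gam c < 0 :=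
  one_div_neg.2 (by linarith [hf.subluminal])

theorem IsSubluminalLibrationalWave.hasDerivAt_deriv {c : ℝ} {f : ℝ → ℝ}
    (hf : IsSubluminalLibrationalWave c f) (z : ℝ) :
    HasDerivAt (deriv f) (-gam c * Real.sin (f z)) z := by
  have h := (hf.differentiable_deriv z).hasDerivAt
  have hc : c ^ 2 - 1 ≠ 0 := by linarith [hf.subluminal]
  have : deriv (deriv f) z = -gam c * Real.sin (f z) := by
    rw [gam]; field_simp; linarith [hf.pendulum z]
  rwa [this] at h

/-- A subluminal librational wave is a libration about an odd multiple of `π`. -/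
theorem IsSubluminalLibrationalWave.exists_pendulum {c : ℝ} {f : ℝ → ℝ}
    (hf : IsSubluminalLibrationalWave c f) :
    ∃ (n : ℤ) (e : ℝ), IsPendulumLibration (-gam c) e
      (fun z => f z - Real.pi - n * (2 * Real.pi)) (deriv f) := by
  have hc : c ^ 2 - 1 ≠ 0 := by linarith [hf.subluminal]
  have hsin : ∀ (n : ℤ) x, Real.sin (x - Real.pi - n * (2 * Real.pi)) = -Real.sin x :=
    fun n x => by rw [Real.sin_sub_int_mul_two_pi, Real.sin_sub_pi]
  have hcos : ∀ (n : ℤ) x, Real.cos (x - Real.pi - n * (2 * Real.pi)) = -Real.cos x :=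
    fun n x => by rw [Real.cos_sub_int_mul_two_pi, Real.cos_sub_pi]
  have hE : ∀ z, HasDerivAt (fun x => phaseEnergy c (f x) (deriv f x)) 0 z := fun z => by
    refine (((((hf.hasDerivAt_deriv z).fun_pow 2).const_mul ((1 / 2) * (c ^ 2 - 1))).add_const
      (1 : ℝ)).fun_sub (hf.differentiable z).hasDerivAt.cos).congr_deriv ?_
    rw [gam]; push_cast; field_simp; ring
  have hconst := fun z =>
    is_const_of_deriv_eq_zero (fun z => (hE z).differentiableAt) (fun z => (hE z).deriv) z 0
  -- At a multiple of `2π` the energy would be `(c² - 1) v² / 2 ≤ 0`. Hence `f` is trapped between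
  -- two consecutive multiples.
  have hne : ∀ z (k : ℤ), f z ≠ k * (2 * Real.pi) := fun z k hk => by
    have := (hf.orbit_inside z).1
    simp only [phaseEnergy, hk, Real.cos_int_mul_two_pi] at this
    nlinarith [hf.subluminal, mul_nonneg (sub_nonneg.2 hf.subluminal.le) (sq_nonneg (deriv f z))]
  have hpi := Real.two_pi_pos
  set n : ℤ := ⌊f 0 / (2 * Real.pi)⌋ with hn
  have hn1 : n * (2 * Real.pi) ≤ f 0 := (le_div_iff₀ hpi).1 (Int.floor_le _)
  have hn2 : f 0 ≤ (n + 1 : ℤ) * (2 * Real.pi) := by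
    push_cast
    exact ((div_lt_iff₀ hpi).1 (Int.lt_floor_add_one _)).le
  have hlow : ∀ z, n * (2 * Real.pi) < f z := fun z => by
    by_contra! hle
    obtain ⟨w, hw⟩ := mem_range_of_exists_le_of_exists_ge hf.differentiable.continuous
      ⟨z, hle⟩ ⟨0, hn1⟩
    exact hne w n hw
  have hup : ∀ z, f z < (n + 1 : ℤ) * (2 * Real.pi) := fun z => by
    by_contra! hle
    obtain ⟨w, hw⟩ := mem_range_of_exists_le_of_exists_ge hf.differentiable.continuous
      ⟨0, hn2⟩ ⟨z, hle⟩
    exact hne w (n + 1) hw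
  refine ⟨n, phaseEnergy c (f 0) (deriv f 0), by linarith [hf.gam_neg], (hf.orbit_inside 0).1,
    (hf.orbit_inside 0).2, fun z => ?_, fun z => ?_, fun z => ?_, fun z => ?_⟩
  · exact ((hf.differentiable z).hasDerivAt.sub_const _).sub_const _
  · rw [hsin]
    exact (hf.hasDerivAt_deriv z).congr_deriv (by ring)
  · rw [hcos, ← hconst z, phaseEnergy, gam]
    field_simp
    ring
  · have h1 := hlow z
    have h2 := hup z
    push_cast at h2
    rw [abs_lt]
    constructor <;> linarith

/-! ### The spectral problem at real `lam` and its half-period monodromy -/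

/-- The potential of the spectral problem written as `p'' = q p + 2 c γ lam p'`. -/
noncomputable def potential (c : ℝ) (f : ℝ → ℝ) (lam z : ℝ) : ℝ :=
  -gam c * (lam ^ 2 + Real.cos (f z))

theorem abs_potential_le (c : ℝ) (f : ℝ → ℝ) (lam z : ℝ) :
    |potential c f lam z| ≤ |gam c| * (lam ^ 2 + 1) := by
  rw [potential, abs_mul, abs_neg]
  gcongr
  refine (abs_add_le _ _).trans ?_
  rw [abs_of_nonneg (sq_nonneg lam)]
  gcongr
  exact Real.abs_cos_le_one _

theorem IsSecondOrderFundamental.isFundamentalMatrix {c : ℝ} {f : ℝ → ℝ} {lam : ℝ}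
    {F : ℝ → Matrix (Fin 2) (Fin 2) ℝ}
    (h : IsSecondOrderFundamental (potential c f lam) (2 * c * gam c * lam) F) :
    IsFundamentalMatrix (coeffMatrix c f lam) (fun z => (F z).map Complex.ofReal) where
  initial := by simp [h.initial]
  hasDerivAt z i j := by
    fin_cases i
    · simpa [coeffMatrix, Matrix.mul_apply] using (h.hasDerivAt_zero z j).ofReal_comp
    · simpa [coeffMatrix, potential, Matrix.mul_apply] using (h.hasDerivAt_one z j).ofReal_comp

theorem IsFundamentalMatrix.hasDerivAt_rows {c : ℝ} {f : ℝ → ℝ} {lam : ℝ}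
    {F : ℝ → Matrix (Fin 2) (Fin 2) ℂ} (h : IsFundamentalMatrix (coeffMatrix c f lam) F)
    (j : Fin 2) (z : ℝ) : HasDerivAt (fun x => F x 0 j) (F z 1 j) z ∧
      HasDerivAt (fun x => F x 1 j)
        (potential c f lam z • F z 0 j + (2 * c * gam c * lam) • F z 1 j) z := by
  constructor
  · simpa [coeffMatrix, Matrix.mul_apply] using h.hasDerivAt z 0 j
  · simpa [coeffMatrix, potential, Matrix.mul_apply] using h.hasDerivAt z 1 j

theorem IsFundamentalMatrix.unique {c : ℝ} {f : ℝ → ℝ} {lam : ℝ}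
    {F G : ℝ → Matrix (Fin 2) (Fin 2) ℂ} (hF : IsFundamentalMatrix (coeffMatrix c f lam) F)
    (hG : IsFundamentalMatrix (coeffMatrix c f lam) G) : F = G := by
  have key := fun j => second_order_unique (abs_potential_le c f lam)
    (fun z => (hF.hasDerivAt_rows j z).1) (fun z => (hF.hasDerivAt_rows j z).2)
    (fun z => (hG.hasDerivAt_rows j z).1) (fun z => (hG.hasDerivAt_rows j z).2)
    (by rw [hF.initial, hG.initial]) (by rw [hF.initial, hG.initial])
  funext z
  ext i j
  fin_cases i
  · exact congrFun (key j).1 z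
  · exact congrFun (key j).2 z

/-- A fixed vector of the real monodromy matrix over one period of the potential yields a
bounded solution of the spectral problem. -/
theorem IsSecondOrderFundamental.mem_temporalSpectrum {c : ℝ} {f : ℝ → ℝ} {lam S : ℝ}
    {F : ℝ → Matrix (Fin 2) (Fin 2) ℝ}
    (h : IsSecondOrderFundamental (potential c f lam) (2 * c * gam c * lam) F) (hS : S ≠ 0)
    (hper : ∀ z, potential c f lam (z + S) = potential c f lam z) {v : Fin 2 → ℝ} (hv : v ≠ 0)
    (hfix : (F S).mulVec v = v) : (lam : ℂ) ∈ temporalSpectrum c f := by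
  have hd : ∀ i z, (F z).mulVec v i = F z i 0 * v 0 + F z i 1 * v 1 := fun i z => by
    simp [Matrix.mulVec, dotProduct]
  have hr : ∀ z, HasDerivAt (fun x => (F x).mulVec v 0) ((F z).mulVec v 1) z := fun z => by
    simp_rw [hd]
    exact ((h.hasDerivAt_zero z 0).mul_const _).fun_add ((h.hasDerivAt_zero z 1).mul_const _)
  have hs : ∀ z, HasDerivAt (fun x => (F x).mulVec v 1) (potential c f lam z * (F z).mulVec v 0
      + 2 * c * gam c * lam * (F z).mulVec v 1) z := fun z => by
    simp_rw [hd]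
    exact (((h.hasDerivAt_one z 0).mul_const _).fun_add
      ((h.hasDerivAt_one z 1).mul_const _)).congr_deriv (by ring)
  have hp : ∀ z, HasDerivAt (fun x => ((F x).mulVec v 0 : ℂ)) ((F z).mulVec v 1 : ℝ) z :=
    fun z => (hr z).ofReal_comp
  have hp' : deriv (fun x => ((F x).mulVec v 0 : ℂ)) = fun z => (((F z).mulVec v 1 : ℝ) : ℂ) :=
    funext fun z => (hp z).deriv
  have hP : Function.Periodic (fun x => ((F x).mulVec v 0 : ℂ)) S := fun z => by
    simp only [h.add_period (abs_potential_le c f lam) hper, ← Matrix.mulVec_mulVec, hfix]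
  refine ⟨fun x => ((F x).mulVec v 0 : ℂ), ⟨fun z => (hp z).differentiableAt, ?_, ?_⟩, ?_, ?_⟩
  · rw [hp']
    exact fun z => (hs z).ofReal_comp.differentiableAt
  · intro z
    rw [hp', (hs z).ofReal_comp.deriv, potential]
    push_cast
    ring
  · intro h0
    have hr0 : ∀ z, (F z).mulVec v 0 = 0 := fun z => Complex.ofReal_eq_zero.1 (congrFun h0 z)
    have hs0 : (F 0).mulVec v 1 = 0 := by
      have := hr 0
      simp_rw [hr0] at this
      exact this.unique (hasDerivAt_const _ _)
    refine hv (funext fun i => ?_)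
    fin_cases i
    · simpa [h.initial] using hr0 0
    · simpa [h.initial] using hs0
  · obtain ⟨C, hC⟩ := (hP.isBounded_of_continuous hS
      (continuous_iff_continuousAt.2 fun z => (hp z).continuousAt)).exists_norm_le
    exact ⟨C, fun z => hC _ (mem_range_self z)⟩

/-- Uniqueness of the fundamental matrix lets any chosen `F` compute the multipliers, which is what
makes the negative claim about `-1` accessible. -/
theorem IsFundamentalMatrix.isFloquetMultiplier_iff {c : ℝ} {f : ℝ → ℝ} {lam T : ℝ} {ρ : ℂ}
    {F : ℝ → Matrix (Fin 2) (Fin 2) ℂ} (h : IsFundamentalMatrix (coeffMatrix c f lam) F) :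
    IsFloquetMultiplier c f T lam ρ ↔ ∃ v, v ≠ 0 ∧ (F T).mulVec v = ρ • v := by
  constructor
  · rintro ⟨_, ⟨G, hG, rfl⟩, he⟩
    obtain ⟨v, hv⟩ := he.exists_hasEigenvector
    exact ⟨v, hv.2, by simpa [hG.unique h] using hv.apply_eq_smul⟩
  · rintro ⟨v, hv, he⟩
    exact ⟨F T, ⟨F, h, rfl⟩, Module.End.hasEigenvalue_of_hasEigenvector
      (x := v) ⟨Module.End.mem_eigenspace_iff.2 (by simpa using he), hv⟩⟩

/-- At `lam = 0` the derivative of the wave solves the spectral problem, so an antiperiodic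
derivative forces the trace of the half-period monodromy matrix to be `-2`. -/
theorem IsSubluminalLibrationalWave.trace_eq_neg_two {c : ℝ} {f : ℝ → ℝ}
    (hf : IsSubluminalLibrationalWave c f) {S : ℝ} (hS : ∀ z, deriv f (z + S) = -deriv f z)
    {F : ℝ → Matrix (Fin 2) (Fin 2) ℝ} (h : IsSecondOrderFundamental (potential c f 0) 0 F) :
    F S 0 0 + F S 1 1 = -2 := by
  have h2 : ∀ z, HasDerivAt (fun x => -gam c * Real.sin (f x))
      (potential c f 0 z * deriv f z + 0 * (-gam c * Real.sin (f z))) z := fun z => by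
    refine ((hf.differentiable z).hasDerivAt.sin.const_mul (-gam c)).congr_deriv ?_
    rw [potential]
    ring
  have hS2 : -gam c * Real.sin (f (0 + S)) = -(-gam c * Real.sin (f 0)) := by
    have h1 := (hf.hasDerivAt_deriv (0 + S)).comp_add_const 0 S
    rw [funext hS] at h1
    exact h1.unique (hf.hasDerivAt_deriv 0).fun_neg
  obtain ⟨h3, h4⟩ := h.eq_comb (abs_potential_le c f 0) hf.hasDerivAt_deriv h2 S
  have hS0 := hS 0
  rw [zero_add] at hS0 hS2
  have hdet := h.det_eq S
  rw [zero_mul, Real.exp_zero] at hdet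
  -- Vanishing data would be an equilibrium, whose energy is `0` or `2`.
  have hv : ![deriv f 0, -gam c * Real.sin (f 0)] ≠ 0 := by
    intro h0
    have h5 : deriv f 0 = 0 := congrFun h0 0
    have h6 : -gam c * Real.sin (f 0) = 0 := congrFun h0 1
    have h7 : Real.sin (f 0) = 0 := by
      rcases mul_eq_zero.1 h6 with h8 | h8
      · linarith [hf.gam_neg]
      · exact h8
    obtain ⟨h8, h9⟩ := hf.orbit_inside 0
    simp only [phaseEnergy, h5] at h8 h9
    rcases Real.sin_eq_zero_iff_cos_eq.1 h7 with h10 | h10 <;> rw [h10] at h8 h9 <;> linarith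
  have h10 := Matrix.exists_mulVec_eq_zero_iff.1 ⟨_, hv, show (F S + 1).mulVec _ = 0 by
    funext i
    fin_cases i <;> simp [Matrix.mulVec, dotProduct, Matrix.one_apply] <;> linarith⟩
  simp [Matrix.det_fin_two] at h10
  linarith

/-- There is a positive `lam` at which the half-period monodromy matrix has eigenvalue `1`. -/
theorem IsSubluminalLibrationalWave.exists_half_period_eigenvalue {c : ℝ} {f : ℝ → ℝ}
    (hf : IsSubluminalLibrationalWave c f) {S : ℝ} (hS0 : 0 < S)
    (hS : ∀ z, deriv f (z + S) = -deriv f z)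
    (hcos : ∀ z, Real.cos (f (z + S)) = Real.cos (f z)) :
    ∃ lam : ℝ, 0 < lam ∧ ∃ F,
      IsSecondOrderFundamental (potential c f lam) (2 * c * gam c * lam) F ∧
        1 + Real.exp (2 * c * gam c * lam * S) = F S 0 0 + F S 1 1 := by
  have hfc := hf.differentiable.continuous
  obtain ⟨F, hF, hFc⟩ := exists_secondOrderFundamental_family
    (q := fun l z => potential c f l z) (d := fun l => 2 * c * gam c * l)
    (by simp only [Function.uncurry_def, potential]; fun_prop) (by fun_prop) hS0.ne'
    (fun l z => by simp only [potential, hcos])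
  have hcont : Continuous fun l : unitInterval =>
      1 + Real.exp (2 * c * gam c * l * S) - (F l S 0 0 + F l S 1 1) := by
    have := hFc S 0 0
    have := hFc S 1 1
    fun_prop
  have h0 : F 0 S 0 0 + F 0 S 1 1 = -2 := hf.trace_eq_neg_two hS (by simpa using hF 0)
  have h1 : 1 + Real.exp (2 * c * gam c * (1 : unitInterval) * S) ≤ F 1 S 0 0 + F 1 S 1 1 :=
    (hF 1).one_add_exp_le_trace (fun z => by
      have h2 := Real.neg_one_le_cos (f z)
      have h3 := hf.gam_neg
      simp only [potential, Icc.coe_one]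
      exact mul_nonneg (by linarith) (by linarith)) hS0.le
  obtain ⟨l, hl⟩ := mem_range_of_exists_le_of_exists_ge (c := 0) hcont ⟨1, by linarith⟩
    ⟨0, by
      have := Real.exp_pos (2 * c * gam c * (0 : unitInterval) * S)
      linarith⟩
  refine ⟨l, lt_of_le_of_ne l.2.1 fun hl0 => ?_, F l, hF l, by simpa [sub_eq_zero] using hl⟩
  have hl0' : l = 0 := Subtype.ext hl0.symm
  simp only [hl0', h0] at hl
  have := Real.exp_pos (2 * c * gam c * (0 : unitInterval) * S)
  linarith

/-- The square of a real `2 × 2` matrix with eigenvalue `1` does not have eigenvalue `-1`. -/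
theorem sq_mulVec_ne_neg {M : Matrix (Fin 2) (Fin 2) ℝ} {δ : ℝ} (hδ : M.det = δ)
    (htr : 1 + δ = M 0 0 + M 1 1) {w : Fin 2 → ℂ} (hw : w ≠ 0) :
    ((M * M).map Complex.ofReal).mulVec w ≠ (-1 : ℂ) • w := by
  intro he
  have h1 := Matrix.exists_mulVec_eq_zero_iff.1 ⟨w, hw,
    show ((M * M).map Complex.ofReal + 1).mulVec w = 0 by
      rw [Matrix.add_mulVec, he]; simp⟩
  have h2 : ((M * M + 1).det : ℂ) = 0 := by
    rw [← h1]
    simp [Matrix.det_fin_two]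
  have h3 : (M * M + 1).det = 0 := Complex.ofReal_eq_zero.1 h2
  -- The eigenvalues of `M` are `1` and `δ`, so the determinant is `(1 + 1) * (1 + δ ^ 2)`.
  have h4 : (M * M + 1).det = 2 + 2 * δ ^ 2 := by
    rw [Matrix.det_fin_two] at hδ ⊢
    simp only [Matrix.add_apply, Matrix.mul_apply, Fin.sum_univ_two, Matrix.one_apply]
    simp
    have h5 : ∀ x y z w : ℝ, (x * x + y * z + 1) * (z * y + w * w + 1)
        - (x * y + y * w) * (z * x + w * z)
        = 1 + (x + w) ^ 2 - 2 * (x * w - y * z) + (x * w - y * z) ^ 2 := by intros; ring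
    rw [h5, ← htr, hδ]
    ring
  linarith [sq_nonneg δ]

theorem IsSubluminalLibrationalWave.exists_isFundamentalPeriod {c : ℝ} {f : ℝ → ℝ}
    (hf : IsSubluminalLibrationalWave c f) :
    ∃ S, 0 < S ∧ IsFundamentalPeriod f (S + S) ∧ (∀ z, deriv f (z + S) = -deriv f z) ∧
      ∀ z, Real.cos (f (z + S)) = Real.cos (f z) := by
  obtain ⟨n, e, h⟩ := hf.exists_pendulum
  obtain ⟨S, hS0, hS, hmin⟩ := h.exists_half_period
  have hfS : ∀ z, f (z + S) = 2 * Real.pi + n * (2 * (2 * Real.pi)) - f z := fun z => by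
    linarith [hS z]
  refine ⟨S, hS0, ⟨⟨by linarith, fun z => ⟨0, ?_⟩⟩, fun T hT => ?_⟩, fun z => ?_, fun z => ?_⟩
  · rw [← add_assoc, hfS, hfS]
    simp
  · rw [← two_mul]
    refine hmin T hT.1 fun z => ?_
    obtain ⟨k, hk⟩ := hT.2 z
    have h1 := abs_lt.1 (h.abs_lt_pi z)
    have h2 := abs_lt.1 (h.abs_lt_pi (z + T))
    have hpi := Real.pi_pos
    -- The motion stays in an open interval of length `2π`, so a period modulo `2π` is a true
    -- period.
    have hk0 : k = 0 := by
      have h3 : (k : ℝ) < 1 := by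
        by_contra! hc
        nlinarith
      have h4 : (-1 : ℝ) < k := by
        by_contra! hc
        nlinarith
      have h5 : k < 1 := by exact_mod_cast h3
      have h6 : -1 < k := by exact_mod_cast h4
      omega
    simp [hk, hk0]
  · have h1 := (hf.differentiable (z + S)).hasDerivAt.comp_add_const z S
    rw [funext hfS] at h1
    exact h1.unique ((hf.differentiable z).hasDerivAt.const_sub _)
  · rw [hfS, show 2 * Real.pi + n * (2 * (2 * Real.pi)) - f z
      = ((1 + 2 * n : ℤ) : ℝ) * (2 * Real.pi) - f z by push_cast; ring,
      Real.cos_int_mul_two_pi_sub]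

end SineGordon

theorem mainTheorem3 (c : ℝ) (f : ℝ → ℝ)
    (hf : SineGordon.IsSubluminalLibrationalWave c f) :
    ∃ T : ℝ, SineGordon.IsFundamentalPeriod f T ∧
      ∃ lam : ℝ, 0 < lam ∧
        (lam : ℂ) ∈ SineGordon.temporalSpectrum c f ∧
        SineGordon.IsFloquetMultiplier c f T (lam : ℂ) 1 ∧
        ¬ SineGordon.IsFloquetMultiplier c f T (lam : ℂ) (-1) := by
  obtain ⟨S, hS0, hT, hS, hcos⟩ := hf.exists_isFundamentalPeriod
  obtain ⟨lam, hlam, F, hF, htr⟩ := hf.exists_half_period_eigenvalue hS0 hS hcos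
  have hper : ∀ z, SineGordon.potential c f lam (z + S) = SineGordon.potential c f lam z :=
    fun z => by simp only [SineGordon.potential, hcos]
  have hdet := hF.det_eq S
  obtain ⟨v, hv, hfix⟩ : ∃ v, v ≠ 0 ∧ (F S - 1).mulVec v = 0 := by
    refine Matrix.exists_mulVec_eq_zero_iff.2 ?_
    simp [Matrix.det_fin_two]
    linarith
  rw [Matrix.sub_mulVec, Matrix.one_mulVec, sub_eq_zero] at hfix
  have hsq : F (S + S) = F S * F S :=
    hF.add_period (SineGordon.abs_potential_le c f lam) hper S
  refine ⟨S + S, hT, lam, hlam, hF.mem_temporalSpectrum hS0.ne' hper hv hfix, ?_, ?_⟩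
  · refine hF.isFundamentalMatrix.isFloquetMultiplier_iff.2 ⟨fun i => (v i : ℂ), fun h0 => ?_, ?_⟩
    · exact hv (funext fun i => Complex.ofReal_eq_zero.1 (congrFun h0 i))
    · have h2 : (F (S + S)).mulVec v = v := by rw [hsq, ← Matrix.mulVec_mulVec, hfix, hfix]
      funext i
      have := congrArg Complex.ofReal (congrFun h2 i)
      simpa [Matrix.mulVec, dotProduct] using this
  · rw [hF.isFundamentalMatrix.isFloquetMultiplier_iff]
    rintro ⟨w, hw, he⟩
    rw [hsq] at he
    exact SineGordon.sq_mulVec_ne_neg (by rw [Matrix.det_fin_two, hdet]) htr hw he
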